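/- Let $z_0\in\mathbb C$ and let $f$ be a function that is holomorphic near $z_0$ and not constant near $z_0$, and for which $z_0$ is a superattracting fixed point, i.e. $f(z_0)=z_0$ and $f'(z_0)=0$. Let $p:=\min\{n\ge 1: f^{(n)}(z_0)\ne 0\}$ (so $p\ge 2$). Let $U$ be an open neighbourhood of $z_0$ on which $f$ is defined, with $f(U)\subset U$, let $V\subset\{w\in\mathbb C:|w|<1\}$ be an open neighbourhood of $0$, and let $\varphi:U\to V$ be a conformal (biholomorphic) map with $\varphi(f(z))=\varphi(z)^p$ for all $z\in U$. (Such $U,V,\varphi$ exist by Böttcher's theorem.) Let $\delta>0$ with $\{w\in\mathbb C:|w|\le\delta\}\subset V$, and put $B_\delta:=\varphi^{-1}(\{w:|w|\le\delta\})$, a compact neighbourhood of $z_0$. Let $H(\mathbb C\setminus\{z_0\})$ be the space of holomorphic functions on $\mathbb C\setminus\{z_0\}$ with the topology of locally uniform convergence, and let $\mathcal K(B_\delta)$ be the space of nonempty compact subsets of $B_\delta$ with the Hausdorff metric. For compact $K\subset\mathbb C$, let $C(K)$ be the space of continuous functions $K\to\mathbb C$ with the uniform norm, and let $f^n$ be the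 $n$-th iterate of $f$. Then comeager many $g\in H(\mathbb C\setminus\{z_0\})$ have the following property: for comeager many $K\in\mathcal K(B_\delta)$, the set $K$ and all its images $f^n(K)$ are contained in $\mathbb C\setminus\{z_0\}$, and $\{g\circ f^n|_K:n\ge 1\}$ is dense in $C(K)$. -/

import Mathlib

open Set Filter Topology TopologicalSpace

/-- The space `H(Ω)` of holomorphic functions on `Ω` (open in all uses), as a subspace of the space
`C(Ω, ℂ)` with the compact-open topology, i.e. with the topology of locally uniform convergence. -/
abbrev HolFun (Ω : Set ℂ) : Type :=
  {g : C(Ω, ℂ) // ∃ F : ℂ → ℂ, DifferentiableOn ℂ F Ω ∧ ∀ z : Ω, F z = g z}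

/-- The functions `g ∘ f^n` restricted to `M`, for `n ≥ 1`, as elements of `C(M, ℂ)`; the `n`-th of
them is present whenever `f^n` maps `M` into the domain `Ω` of `g` (and the composition is
continuous on `M`). -/
def compIterates (f : ℂ → ℂ) {Ω : Set ℂ} (g : HolFun Ω) (M : Set ℂ) : Set C(M, ℂ) :=
  {h | ∃ n : ℕ, 1 ≤ n ∧ ∀ z : M, ∃ hz : f^[n] z ∈ Ω, h z = g.1 ⟨f^[n] z, hz⟩}

/-- `g ∈ H(Ω)` is `𝓕`-universal for the composition operator `C_f`, where `𝓕 ⊆ C(M)`: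
`M` and all its forward images lie in `Ω`, and every element of `𝓕` is a limit in `C(M)` of
functions `g ∘ f^n` restricted to `M`. For compact `M`, the topology of `C(M, ℂ)` is that
of the uniform norm. -/
def IsUniversalFor (f : ℂ → ℂ) {Ω : Set ℂ} (g : HolFun Ω) (M : Set ℂ) (𝓕 : Set C(M, ℂ)) : Prop :=
  (∀ n : ℕ, MapsTo f^[n] M Ω) ∧ 𝓕 ⊆ closure (compIterates f g M)

/-- `z₀` is a superattracting fixed point of `f`, which is holomorphic near `z₀`. -/
structure IsSuperattractingFixedPt (f : ℂ → ℂ) (z₀ : ℂ) : Prop where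
  analyticAt : AnalyticAt ℂ f z₀
  map_eq : f z₀ = z₀
  deriv_eq : deriv f z₀ = 0

/-- The least `n ≥ 1` with `f^(n)(z₀) ≠ 0` (it exists if `f` is analytic and not constant
near `z₀`). -/
noncomputable def localOrder (f : ℂ → ℂ) (z₀ : ℂ) : ℕ :=
  sInf {n : ℕ | 1 ≤ n ∧ iteratedDeriv n f z₀ ≠ 0}

/-- `φ : U → V` is a Böttcher map of `f` at `z₀`: a conformal (that is, biholomorphic) map between
an open neighbourhood `U` of `z₀` with `f(U) ⊆ U` and an open neighbourhood `V ⊆ 𝔻` of `0`, which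
conjugates `f` on `U` to the monomial `w ↦ w ^ p` on `V`, `p` being the local order of `f`
at `z₀`. -/
structure IsBottcherMap (f : ℂ → ℂ) (z₀ : ℂ) (U V : Set ℂ) (φ : ℂ → ℂ) : Prop where
  isOpen_source : IsOpen U
  mem_source : z₀ ∈ U
  isOpen_target : IsOpen V
  zero_mem_target : (0 : ℂ) ∈ V
  target_subset : V ⊆ Metric.ball (0 : ℂ) 1
  mapsTo : MapsTo f U U
  differentiableOn : DifferentiableOn ℂ φ U
  bijOn : BijOn φ U V
  conj : ∀ z ∈ U, φ (f z) = φ z ^ localOrder f z₀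

/-- The compact neighbourhood `B_δ = φ⁻¹({w : |w| ≤ δ})` of `z₀`, for a map `φ` defined on `U`. -/
def bottcherNhd (U : Set ℂ) (φ : ℂ → ℂ) (δ : ℝ) : Set ℂ :=
  U ∩ φ ⁻¹' Metric.closedBall (0 : ℂ) δ

/-! Since `φ (f^[n] z) = φ z ^ p ^ n`, orbits starting in `U \ {z₀}` tend to `z₀` without reaching
it, and two orbits with different `‖φ‖` never merge. Take a countable dense `D ⊆ B_δ \ {z₀}` on
which `‖φ‖` is injective. For finite `S ⊆ D`, some `f^[n]` carries `S` to distinct points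
arbitrarily near `z₀`, where a correction that is small away from `z₀` gives `g` any prescribed
values. So approximating a given target on `S` by some `g ∘ f^[n]` is an open dense condition on
`g`; there are countably many `S`, targets and tolerances. For such a `g`, approximating a target on
`K` is an open condition on `K`, satisfied by the dense family of finite subsets of `D`. Targets
from a dense sequence in `C(ℂ, ℂ)` suffice, by Tietze extension. -/

/-- In a second countable space, if `u` takes infinitely many values on `O ∩ P` for every nonempty
open set `O`, then `P` contains a countable dense set on which `u` is injective. -/
theorem exists_countable_dense_injOn {X Y : Type*} [TopologicalSpace X]
    [SecondCountableTopology X] (u : X → Y) (P : Set X)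
    (h : ∀ O : Set X, IsOpen O → O.Nonempty → (u '' (O ∩ P)).Infinite) :
    ∃ D : Set X, D.Countable ∧ Dense D ∧ D ⊆ P ∧ InjOn u D := by
  classical
  have : Encodable (countableBasis X) := (countable_countableBasis X).toEncodable
  have hinf (b : countableBasis X) : (u '' (b.1 ∩ P)).Infinite :=
    h _ (isOpen_of_mem_countableBasis b.2) (nonempty_of_mem_countableBasis b.2)
  -- With `encode b + 1` candidate values for `b`, Hall's marriage condition holds: a finite family
  -- has at most as many members as its largest code plus one.
  choose t ht htcard using fun b ↦ (hinf b).exists_subset_card_eq (Encodable.encode b + 1)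
  obtain ⟨y, hyinj, hy⟩ := (Finset.all_card_le_biUnion_card_iff_exists_injective t).1 <| by
    intro s
    rcases s.eq_empty_or_nonempty with rfl | hs
    · simp
    obtain ⟨b, hb, hmax⟩ := s.exists_max_image Encodable.encode hs
    calc s.card = (s.image Encodable.encode).card :=
          (Finset.card_image_of_injective _ Encodable.encode_injective).symm
      _ ≤ (Finset.range (Encodable.encode b + 1)).card := by
          refine Finset.card_le_card fun n hn ↦ ?_
          obtain ⟨c, hc, rfl⟩ := Finset.mem_image.1 hn
          exact Finset.mem_range.2 (Nat.lt_succ_of_le (hmax c hc))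
      _ = (t b).card := by rw [Finset.card_range, htcard]
      _ ≤ _ := Finset.card_le_card (Finset.subset_biUnion_of_mem t hb)
  choose x hx hxy using fun b ↦ ht b (hy b)
  refine ⟨range x, countable_range x, ?_, ?_, ?_⟩
  · refine (isBasis_countableBasis X).dense_iff.2 fun O hO _ ↦ ?_
    exact ⟨x ⟨O, hO⟩, (hx ⟨O, hO⟩).1, mem_range_self _⟩
  · rintro _ ⟨b, rfl⟩
    exact (hx b).2
  · rintro _ ⟨b, rfl⟩ _ ⟨c, rfl⟩ hbc
    rw [hxy, hxy] at hbc
    rw [hyinj hbc]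

/-! ### Generic approximation on finite sets -/

/-- Values at finitely many points close to `z₀` can be interpolated by a holomorphic function on
the punctured plane that is small away from `z₀`. -/
theorem exists_differentiableOn_interpolation (z₀ : ℂ) (S : Finset ℂ) (c : ℂ → ℂ) {r ε : ℝ}
    (hr : 0 < r) (hε : 0 < ε) (hS₀ : ∀ w ∈ S, w ≠ z₀) (hS : ∀ w ∈ S, ‖w - z₀‖ < r) :
    ∃ h : ℂ → ℂ, DifferentiableOn ℂ h {z₀}ᶜ ∧ (∀ w ∈ S, h w = c w) ∧
      ∀ z, r ≤ ‖z - z₀‖ → ‖h z‖ < ε := by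
  classical
  set v : ℂ → ℂ := fun z ↦ (z - z₀)⁻¹ with hv
  have hvinj : InjOn v S := fun a _ b _ hab ↦ by simpa [hv] using hab
  have hv0 : ∀ w ∈ S, v w ≠ 0 := fun w hw ↦ inv_ne_zero (sub_ne_zero.2 (hS₀ w hw))
  set ℓ : ℂ → ℂ → ℂ := fun w u ↦ (Lagrange.basis S v w).eval u with hℓ
  have hbound (w : ℂ) : ∃ M, ∀ u ∈ Metric.closedBall (0 : ℂ) r⁻¹, ‖ℓ w u‖ ≤ M :=
    (isCompact_closedBall _ _).exists_bound_of_continuousOn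
      (Lagrange.basis S v w).continuous.continuousOn
  choose M hM using hbound
  have hlim : Tendsto (fun N : ℕ ↦ ∑ w ∈ S, ‖c w‖ * (r⁻¹ / ‖v w‖) ^ N * M w) atTop (𝓝 0) := by
    rw [show (0 : ℝ) = ∑ w ∈ S, ‖c w‖ * 0 * M w by simp]
    refine tendsto_finsetSum _ fun w hw ↦ Tendsto.mul_const _ (Tendsto.const_mul _ ?_)
    refine tendsto_pow_atTop_nhds_zero_of_lt_one (by positivity) ?_
    rw [div_lt_one (norm_pos_iff.2 (hv0 w hw)), hv, norm_inv]
    exact inv_strictAnti₀ (norm_pos_iff.2 (sub_ne_zero.2 (hS₀ w hw))) (hS w hw)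
  obtain ⟨N, hN⟩ := (hlim.eventually_lt_const hε).exists
  -- Lagrange interpolation in `v = 1 / (z - z₀)`, damped by a factor that is `1` at `w` and decays
  -- with `N` where `‖v z‖ ≤ r⁻¹ < ‖v w‖`.
  refine ⟨fun z ↦ ∑ w ∈ S, c w * (v z / v w) ^ N * ℓ w (v z), ?_, ?_, ?_⟩
  · have hvd : DifferentiableOn ℂ v {z₀}ᶜ := fun z hz ↦
      ((differentiableAt_id.sub_const z₀).inv (sub_ne_zero.2 hz)).differentiableWithinAt
    refine DifferentiableOn.fun_sum fun w _ ↦ DifferentiableOn.mul ?_ ?_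
    · exact ((hvd.div_const _).pow N).const_mul _
    · exact (Lagrange.basis S v w).differentiable.comp_differentiableOn hvd
  · intro w hw
    beta_reduce
    rw [Finset.sum_eq_single_of_mem w hw]
    · simp [hℓ, Lagrange.eval_basis_self hvinj hw, hv0 w hw]
    · intro b hb hbw
      simp [hℓ, Lagrange.eval_basis_of_ne hbw hw]
  · intro z hz
    have hvz : ‖v z‖ ≤ r⁻¹ := by
      rw [hv, norm_inv]
      exact inv_anti₀ hr hz
    refine lt_of_le_of_lt (norm_sum_le_of_le _ fun w hw ↦ ?_) hN
    rw [norm_mul, norm_mul, norm_pow, norm_div]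
    gcongr
    exact hM w _ (by simpa using hvz)

/-- The functions `g` for which some `g ∘ f^n`, `n ≥ 1`, is `ε`-close to `c` on a finite set `S`
form an open set. -/
theorem isOpen_setOf_approx_iterate (f : ℂ → ℂ) {Ω : Set ℂ} {S : Set ℂ} (hS : S.Finite)
    (c : ℂ → ℂ) (ε : ℝ) :
    IsOpen {g : HolFun Ω | ∃ n : ℕ, 1 ≤ n ∧
      ∀ z ∈ S, ∃ hz : f^[n] z ∈ Ω, ‖g.1 ⟨f^[n] z, hz⟩ - c z‖ < ε} := by
  have : {g : HolFun Ω | ∃ n : ℕ, 1 ≤ n ∧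
      ∀ z ∈ S, ∃ hz : f^[n] z ∈ Ω, ‖g.1 ⟨f^[n] z, hz⟩ - c z‖ < ε} =
      ⋃ n : ℕ, ⋃ _ : 1 ≤ n, ⋂ z ∈ S, ⋃ hz : f^[n] z ∈ Ω,
        {g : HolFun Ω | ‖g.1 ⟨f^[n] z, hz⟩ - c z‖ < ε} := by
    ext g
    simp
  rw [this]
  refine isOpen_iUnion fun n ↦ isOpen_iUnion fun _ ↦ hS.isOpen_biInter fun z _ ↦
    isOpen_iUnion fun hz ↦ isOpen_lt ?_ continuous_const
  exact (((continuous_eval_const _).comp continuous_subtype_val).sub continuous_const).norm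

/-- If the orbits of the points of a finite set `S` tend to `z₀`, never reach it and never merge,
then the functions `g` for which some `g ∘ f^n`, `n ≥ 1`, is `ε`-close to `c` on `S` are dense. -/
theorem dense_setOf_approx_iterate (f : ℂ → ℂ) (z₀ : ℂ) {S : Set ℂ} (hS : S.Finite)
    (hne : ∀ n, ∀ z ∈ S, f^[n] z ≠ z₀) (hinj : ∀ n, InjOn f^[n] S)
    (hlim : ∀ z ∈ S, Tendsto (fun n ↦ f^[n] z) atTop (𝓝 z₀)) (c : ℂ → ℂ) {ε : ℝ} (hε : 0 < ε) :
    Dense {g : HolFun ({z₀}ᶜ : Set ℂ) | ∃ n : ℕ, 1 ≤ n ∧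
      ∀ z ∈ S, ∃ hz : f^[n] z ∈ ({z₀}ᶜ : Set ℂ), ‖g.1 ⟨f^[n] z, hz⟩ - c z‖ < ε} := by
  classical
  intro g₀
  obtain ⟨F, hF, hFg⟩ := g₀.2
  have key (m : ℕ) : ∃ (n : ℕ) (h : ℂ → ℂ), 1 ≤ n ∧ DifferentiableOn ℂ h {z₀}ᶜ ∧
      (∀ z ∈ S, h (f^[n] z) = c z - F (f^[n] z)) ∧
      ∀ z, 1 / ((m : ℝ) + 1) ≤ ‖z - z₀‖ → ‖h z‖ < 1 / ((m : ℝ) + 1) := by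
    have hm : 0 < 1 / ((m : ℝ) + 1) := Nat.one_div_pos_of_nat
    have hev : ∀ᶠ n in atTop, ∀ z ∈ S, ‖f^[n] z - z₀‖ < 1 / ((m : ℝ) + 1) :=
      (eventually_all_finite hS).2 fun z hz ↦ by
        simpa [dist_eq_norm] using Metric.tendsto_nhds.1 (hlim z hz) _ hm
    obtain ⟨n, hn, hn1⟩ := (hev.and (eventually_ge_atTop 1)).exists
    obtain ⟨h, hd, hval, hsmall⟩ := exists_differentiableOn_interpolation z₀
      (hS.toFinset.image f^[n]) (fun w ↦ c (Function.invFunOn f^[n] S w) - F w) hm hm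
      (by simpa using hne n) (by simpa using hn)
    refine ⟨n, h, hn1, hd, fun z hz ↦ ?_, hsmall⟩
    rw [hval _ (Finset.mem_image_of_mem _ (hS.mem_toFinset.2 hz)),
      (hinj n).leftInvOn_invFunOn hz]
  choose n h hn hd hval hsmall using key
  let G (m : ℕ) : HolFun ({z₀}ᶜ : Set ℂ) :=
    ⟨⟨fun z ↦ g₀.1 z + h m z, g₀.1.continuous.add (hd m).continuousOn.domRestrict⟩,
      fun z ↦ F z + h m z, hF.add (hd m), fun z ↦ by simp [hFg]⟩
  have hG (m : ℕ) (z : ({z₀}ᶜ : Set ℂ)) : (G m).1 z = g₀.1 z + h m z := rfl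
  refine mem_closure_of_tendsto (f := G) (b := atTop) ?_ (Eventually.of_forall fun m ↦
    ⟨n m, hn m, fun z hz ↦ ⟨hne _ z hz, ?_⟩⟩)
  · rw [tendsto_subtype_rng, ContinuousMap.tendsto_iff_forall_isCompact_tendstoUniformlyOn]
    intro K hK
    obtain ⟨ρ, hρ, hρK⟩ : ∃ ρ > 0, ∀ z ∈ K, ρ ≤ ‖(z : ℂ) - z₀‖ := by
      rcases K.eq_empty_or_nonempty with rfl | hKne
      · exact ⟨1, one_pos, by simp⟩
      obtain ⟨x, hx, hmin⟩ := hK.exists_isMinOn hKne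
        (f := fun z : ({z₀}ᶜ : Set ℂ) ↦ ‖(z : ℂ) - z₀‖) (by fun_prop)
      exact ⟨_, norm_pos_iff.2 (sub_ne_zero.2 x.2), fun z hz ↦ hmin hz⟩
    refine Metric.tendstoUniformlyOn_iff.2 fun η hη ↦ ?_
    filter_upwards [tendsto_one_div_add_atTop_nhds_zero_nat.eventually_lt_const (lt_min hρ hη)]
      with m hm z hz
    have := hsmall m z ((hm.le.trans (min_le_left _ _)).trans (hρK z hz))
    simpa [hG, dist_eq_norm] using this.trans (hm.trans_le (min_le_right _ _))
  · have hFz := hFg ⟨f^[n m] z, hne _ z hz⟩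
    simpa [hG, ← hFz, hval m z hz] using hε

/-- The restrictions to a compact set of a dense sequence of continuous functions are dense. -/
theorem denseRange_restrict_of_denseRange {ι : Type*} {q : ι → C(ℂ, ℂ)} (hq : DenseRange q)
    {M : Set ℂ} (hM : IsClosed M) : DenseRange fun j ↦ (q j).restrict M :=
  DenseRange.comp (Function.Surjective.denseRange fun h ↦ h.exists_restrict_eq hM) hq
    (ContinuousMap.continuous_restrict M)

/-! ### Dynamics in the Böttcher coordinate -/

namespace IsBottcherMap

variable {f : ℂ → ℂ} {z₀ : ℂ} {U V : Set ℂ} {φ : ℂ → ℂ}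

theorem norm_lt_one (hφ : IsBottcherMap f z₀ U V φ) {z : ℂ} (hz : z ∈ U) : ‖φ z‖ < 1 := by
  simpa using hφ.target_subset (hφ.bijOn.mapsTo hz)

theorem two_le_localOrder (hφ : IsBottcherMap f z₀ U V φ) (hf : IsSuperattractingFixedPt f z₀) :
    2 ≤ localOrder f z₀ := by
  -- The value `0` is the default `sInf ∅`; it would force `φ (f z₀) = 1`, outside the unit disc.
  have h0 : localOrder f z₀ ≠ 0 := fun h ↦ by
    have := hφ.norm_lt_one (hφ.mapsTo hφ.mem_source)
    simp [hφ.conj z₀ hφ.mem_source, h] at this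
  have hmem := Nat.sInf_mem (Nat.nonempty_of_pos_sInf (Nat.pos_of_ne_zero h0))
  change 1 ≤ localOrder f z₀ ∧ iteratedDeriv (localOrder f z₀) f z₀ ≠ 0 at hmem
  have h1 : localOrder f z₀ ≠ 1 := fun h ↦ hmem.2 (by rw [h, iteratedDeriv_one, hf.deriv_eq])
  omega

theorem map_center (hφ : IsBottcherMap f z₀ U V φ) (hf : IsSuperattractingFixedPt f z₀) :
    φ z₀ = 0 := by
  have hp := hφ.two_le_localOrder hf
  have h := hφ.conj z₀ hφ.mem_source
  rw [hf.map_eq] at h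
  by_contra hne
  have h1 : φ z₀ ^ (localOrder f z₀ - 1) = 1 := by
    apply mul_right_cancel₀ hne
    rw [← pow_succ, one_mul, Nat.sub_add_cancel (by omega), ← h]
  have h2 := pow_lt_one₀ (norm_nonneg _) (hφ.norm_lt_one hφ.mem_source)
    (show localOrder f z₀ - 1 ≠ 0 by omega)
  rw [← norm_pow, h1, norm_one] at h2
  exact lt_irrefl _ h2

theorem eq_zero_iff (hφ : IsBottcherMap f z₀ U V φ) (hf : IsSuperattractingFixedPt f z₀) {z : ℂ}
    (hz : z ∈ U) : φ z = 0 ↔ z = z₀ := by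
  rw [← hφ.map_center hf, hφ.bijOn.injOn.eq_iff hz hφ.mem_source]

/-- Open mapping theorem; injectivity of `φ` rules out local constancy. -/
theorem nhds_le_map (hφ : IsBottcherMap f z₀ U V φ) {z : ℂ} (hz : z ∈ U) :
    𝓝 (φ z) ≤ map φ (𝓝 z) := by
  have hU := hφ.isOpen_source.mem_nhds hz
  refine (hφ.differentiableOn.analyticAt hU).eventually_constant_or_nhds_le_map_nhds.resolve_left
    fun hc ↦ ?_
  have : ∀ᶠ w in 𝓝[≠] z, False := by
    filter_upwards [nhdsWithin_le_nhds hc, nhdsWithin_le_nhds hU, self_mem_nhdsWithin]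
      with w hw hwU hwz using hwz (hφ.bijOn.injOn hwU hz hw)
  exact this.exists.elim fun _ ↦ id

theorem tendsto_of_tendsto {α : Type*} {l : Filter α} (hφ : IsBottcherMap f z₀ U V φ) {u : α → ℂ}
    {z : ℂ} (hz : z ∈ U) (hu : ∀ᶠ a in l, u a ∈ U) (h : Tendsto (fun a ↦ φ (u a)) l (𝓝 (φ z))) :
    Tendsto u l (𝓝 z) := by
  intro N hN
  have hN' : φ '' (N ∩ U) ∈ 𝓝 (φ z) :=
    hφ.nhds_le_map hz (image_mem_map (inter_mem hN (hφ.isOpen_source.mem_nhds hz)))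
  rw [mem_map]
  filter_upwards [hu, h.eventually_mem hN'] with a ha ⟨w, hw, hwa⟩
  simpa [hφ.bijOn.injOn hw.2 ha hwa] using hw.1

/-- Away from `z₀` the regularity of `f` comes only from the conjugacy, through continuity of `φ⁻¹`.
-/
theorem continuousOn (hφ : IsBottcherMap f z₀ U V φ) : ContinuousOn f U := by
  intro z hz
  refine hφ.tendsto_of_tendsto (hφ.mapsTo hz)
    (eventually_nhdsWithin_of_forall fun w hw ↦ hφ.mapsTo hw) ?_
  rw [hφ.conj z hz]
  exact ((hφ.differentiableOn.continuousOn z hz).pow _).congr' <|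
    eventually_nhdsWithin_of_forall fun w hw ↦ (hφ.conj w hw).symm

theorem map_iterate (hφ : IsBottcherMap f z₀ U V φ) {z : ℂ} (hz : z ∈ U) (n : ℕ) :
    φ (f^[n] z) = φ z ^ localOrder f z₀ ^ n := by
  induction n with
  | zero => simp
  | succ n ih =>
    rw [Function.iterate_succ_apply', hφ.conj _ (hφ.mapsTo.iterate n hz), ih, ← pow_mul, pow_succ]

theorem iterate_ne_center (hφ : IsBottcherMap f z₀ U V φ) (hf : IsSuperattractingFixedPt f z₀)
    {z : ℂ} (hz : z ∈ U) (hne : z ≠ z₀) (n : ℕ) : f^[n] z ≠ z₀ := by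
  rw [Ne, ← hφ.eq_zero_iff hf (hφ.mapsTo.iterate n hz), hφ.map_iterate hz]
  exact pow_ne_zero _ ((hφ.eq_zero_iff hf hz).not.2 hne)

theorem tendsto_iterate (hφ : IsBottcherMap f z₀ U V φ) (hf : IsSuperattractingFixedPt f z₀)
    {z : ℂ} (hz : z ∈ U) : Tendsto (fun n ↦ f^[n] z) atTop (𝓝 z₀) := by
  refine hφ.tendsto_of_tendsto hφ.mem_source
    (Eventually.of_forall fun n ↦ hφ.mapsTo.iterate n hz) ?_
  simp_rw [hφ.map_iterate hz, hφ.map_center hf]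
  exact (tendsto_pow_atTop_nhds_zero_of_norm_lt_one (hφ.norm_lt_one hz)).comp
    (tendsto_pow_atTop_atTop_of_one_lt (hφ.two_le_localOrder hf))

/-- Moduli are needed: powers identify points of `V` differing by a root of unity, but are injective
on `[0, ∞)`. -/
theorem injOn_iterate (hφ : IsBottcherMap f z₀ U V φ) (hf : IsSuperattractingFixedPt f z₀)
    {S : Set ℂ} (hS : S ⊆ U) (hinj : InjOn (fun z ↦ ‖φ z‖) S) (n : ℕ) : InjOn f^[n] S := by
  intro a ha b hb hab
  refine hinj ha hb ?_
  have h := congrArg (fun z ↦ ‖φ z‖) hab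
  simp only [hφ.map_iterate (hS ha), hφ.map_iterate (hS hb), norm_pow] at h
  exact (pow_left_inj₀ (norm_nonneg _) (norm_nonneg _)
    (pow_ne_zero n (by have := hφ.two_le_localOrder hf; omega))).1 h

/-- On nonempty relatively open subsets of `B_δ`, the modulus of the Böttcher map takes infinitely
many nonzero values. -/
theorem infinite_norm_image (hφ : IsBottcherMap f z₀ U V φ) {δ : ℝ} (hδ : 0 < δ)
    {O : Set (bottcherNhd U φ δ)} (hO : IsOpen O) (hne : O.Nonempty) :
    ((fun z : bottcherNhd U φ δ ↦ ‖φ z‖) '' (O ∩ {z | φ z ≠ 0})).Infinite := by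
  obtain ⟨O', hO', rfl⟩ := isOpen_induced_iff.1 hO
  obtain ⟨x, hx⟩ := hne
  have hN : φ '' (O' ∩ U) ∈ 𝓝 (φ x) := hφ.nhds_le_map x.2.1
    (image_mem_map (inter_mem (hO'.mem_nhds hx) (hφ.isOpen_source.mem_nhds x.2.1)))
  -- Vary the modulus along the ray through `φ x`, in any direction if `φ x = 0`.
  obtain ⟨e, he, hxe⟩ : ∃ e : ℂ, ‖e‖ = 1 ∧ φ x = (‖φ x‖ : ℂ) * e := by
    rcases eq_or_ne (φ x) 0 with h | h
    · exact ⟨1, by simp, by simp [h]⟩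
    · exact ⟨φ x / ‖φ x‖, by simp [h], (mul_div_cancel₀ _ (by simpa using h)).symm⟩
  have hcont : Continuous fun r : ℝ ↦ (r : ℂ) * e := by fun_prop
  have hev : ∀ᶠ r : ℝ in 𝓝 ‖φ x‖, (r : ℂ) * e ∈ φ '' (O' ∩ U) :=
    hcont.continuousAt.preimage_mem_nhds (by rwa [← hxe])
  obtain ⟨T, hT, hTo, hxT⟩ := eventually_nhds_iff.1 hev
  have hxδ : ‖φ x‖ ≤ δ := by simpa using x.2.2
  have hcl : ‖φ x‖ ∈ closure (Ioo 0 δ) := by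
    rw [closure_Ioo hδ.ne]
    exact ⟨norm_nonneg _, hxδ⟩
  obtain ⟨s, hs⟩ := mem_closure_iff.1 hcl T hTo hxT
  refine (infinite_of_mem_nhds s ((hTo.inter isOpen_Ioo).mem_nhds hs)).mono ?_
  rintro r ⟨hrT, hr0, hrδ⟩
  obtain ⟨w, ⟨hwO, hwU⟩, hw⟩ := hT r hrT
  have hnorm : ‖φ w‖ = r := by simp [hw, he, abs_of_pos hr0]
  refine ⟨⟨w, hwU, by simpa [hnorm] using hrδ.le⟩, ⟨hwO, ?_⟩, hnorm⟩
  change φ w ≠ 0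
  rw [← norm_pos_iff, hnorm]
  exact hr0

/-- The points of `B_δ` at which `g ∘ f^n` is defined and `r`-close to `q` form an open set. -/
theorem isOpen_setOf_norm_sub_lt (hφ : IsBottcherMap f z₀ U V φ) {Ω : Set ℂ} (hΩ : IsOpen Ω)
    {δ : ℝ} (g : HolFun Ω) (n : ℕ) (q : C(ℂ, ℂ)) (r : ℝ) :
    IsOpen {z : bottcherNhd U φ δ | ∃ hz : f^[n] z ∈ Ω, ‖g.1 ⟨f^[n] z, hz⟩ - q z‖ < r} := by
  have hcont : Continuous fun z : bottcherNhd U φ δ ↦ f^[n] z :=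
    (hφ.continuousOn.iterate hφ.mapsTo n).comp_continuous continuous_subtype_val fun z ↦ z.2.1
  refine isOpen_iff_mem_nhds.2 fun z ⟨hz, hzr⟩ ↦ ?_
  obtain ⟨F, hF, hFg⟩ := g.2
  simp only [← hFg] at hzr ⊢
  have hFc : ContinuousAt (fun w : bottcherNhd U φ δ ↦ ‖F (f^[n] w) - q w‖) z := by
    have h1 : ContinuousAt (fun w : bottcherNhd U φ δ ↦ F (f^[n] w)) z :=
      ContinuousAt.comp (f := fun w : bottcherNhd U φ δ ↦ f^[n] w)
        (hF.continuousOn.continuousAt (hΩ.mem_nhds hz)) hcont.continuousAt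
    exact (h1.sub (by fun_prop)).norm
  filter_upwards [hcont.continuousAt.preimage_mem_nhds (hΩ.mem_nhds hz),
    hFc.eventually_lt continuousAt_const hzr] with w hw hwr using ⟨hw, hwr⟩

/-- A function `g` some of whose compositions `g ∘ f^n` approximate the functions of a dense
sequence on a compact set `K ⊆ B_δ` is universal for `K`. -/
theorem isUniversalFor (hφ : IsBottcherMap f z₀ U V φ) (hf : IsSuperattractingFixedPt f z₀)
    {δ : ℝ} {g : HolFun ({z₀}ᶜ : Set ℂ)} {q : ℕ → C(ℂ, ℂ)} (hq : DenseRange q)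
    {K : NonemptyCompacts (bottcherNhd U φ δ)}
    (h : ∀ j m : ℕ, ∃ n : ℕ, 1 ≤ n ∧ (K : Set (bottcherNhd U φ δ)) ⊆
      {z | ∃ hz : f^[n] z ∈ ({z₀}ᶜ : Set ℂ),
        ‖g.1 ⟨f^[n] z, hz⟩ - q j z‖ < 1 / ((m : ℝ) + 1)}) :
    IsUniversalFor f g (Subtype.val '' (K : Set (bottcherNhd U φ δ))) univ := by
  set M : Set ℂ := Subtype.val '' (K : Set (bottcherNhd U φ δ)) with hM
  have hMc : IsCompact M := K.isCompact.image continuous_subtype_val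
  have : CompactSpace M := isCompact_iff_compactSpace.1 hMc
  have hMU : M ⊆ U := by
    rintro _ ⟨z, _, rfl⟩
    exact z.2.1
  have hM₀ : ∀ z ∈ M, z ≠ z₀ := by
    rintro _ ⟨z, hzK, rfl⟩ hz
    -- One approximation already excludes `z₀` from `K`, because `z₀` is fixed and `g` is undefined
    -- there.
    obtain ⟨n, _, hn⟩ := h 0 0
    obtain ⟨hzn, _⟩ := hn hzK
    rw [hz, Function.iterate_fixed hf.map_eq] at hzn
    exact hzn rfl
  have hmaps (n : ℕ) : MapsTo f^[n] M {z₀}ᶜ := fun z hz ↦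
    hφ.iterate_ne_center hf (hMU hz) (hM₀ z hz) n
  refine ⟨hmaps, ?_⟩
  rw [← (denseRange_restrict_of_denseRange hq hMc.isClosed).closure_range]
  refine closure_minimal ?_ isClosed_closure
  rintro _ ⟨j, rfl⟩
  refine Metric.mem_closure_iff.2 fun ε hε ↦ ?_
  obtain ⟨m, hm⟩ := exists_nat_one_div_lt hε
  obtain ⟨n, hn1, hn⟩ := h j m
  have hcont : Continuous fun z : M ↦ g.1 ⟨f^[n] z, hmaps n z.2⟩ :=
    g.1.continuous.comp <| Continuous.subtype_mk
      (((hφ.continuousOn.iterate hφ.mapsTo n).mono hMU).domRestrict) _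
  refine ⟨⟨_, hcont⟩, ⟨n, hn1, fun z ↦ ⟨hmaps n z.2, rfl⟩⟩, ?_⟩
  refine ((ContinuousMap.dist_le (by positivity)).2 ?_).trans_lt hm
  rintro ⟨_, z, hzK, rfl⟩
  obtain ⟨_, hz⟩ := hn hzK
  rw [dist_comm, dist_eq_norm]
  exact hz.le

end IsBottcherMap


/-! ### The two category arguments -/

/-- `NonemptyCompacts B` is the space of nonempty compact subsets of `B` with the Hausdorff metric,
and `∀ᶠ x in residual X` means `for comeager many x ∈ X`. -/
theorem mainTheorem6 (f : ℂ → ℂ) (z₀ : ℂ) (hf : IsSuperattractingFixedPt f z₀)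
    (hconst : ¬ ∀ᶠ z in 𝓝 z₀, f z = z₀)
    (U V : Set ℂ) (φ : ℂ → ℂ) (hφ : IsBottcherMap f z₀ U V φ)
    (δ : ℝ) (hδ : 0 < δ) (hδV : Metric.closedBall (0 : ℂ) δ ⊆ V) :
    ∀ᶠ g in residual (HolFun ({z₀}ᶜ : Set ℂ)),
      ∀ᶠ K : NonemptyCompacts (bottcherNhd U φ δ) in residual _,
        IsUniversalFor f g (Subtype.val '' (K : Set (bottcherNhd U φ δ)))
          (Set.univ : Set C(Subtype.val '' (K : Set (bottcherNhd U φ δ)), ℂ)) := by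
  obtain ⟨D, hDc, hDd, hD₀, hDinj⟩ := exists_countable_dense_injOn
    (fun z : bottcherNhd U φ δ ↦ ‖φ z‖) {z | φ z ≠ 0}
    fun O hO hne ↦ hφ.infinite_norm_image hδ hO hne
  have hq : DenseRange (denseSeq C(ℂ, ℂ)) := denseRange_denseSeq _
  have hg : ∀ᶠ g in residual (HolFun ({z₀}ᶜ : Set ℂ)), ∀ t ∈ {t | t.Finite ∧ t ⊆ D}, ∀ j m : ℕ,
      ∃ n : ℕ, 1 ≤ n ∧ ∀ z ∈ Subtype.val '' t, ∃ hz : f^[n] z ∈ ({z₀}ᶜ : Set ℂ),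
        ‖g.1 ⟨f^[n] z, hz⟩ - denseSeq C(ℂ, ℂ) j z‖ < 1 / ((m : ℝ) + 1) := by
    refine (eventually_countable_ball (countable_ofPred_finite_subset hDc)).2 fun t ⟨htf, htD⟩ ↦
      eventually_countable_forall.2 fun j ↦ eventually_countable_forall.2 fun m ↦ ?_
    have htU : Subtype.val '' t ⊆ U := by
      rintro _ ⟨z, _, rfl⟩
      exact z.2.1
    refine residual_of_dense_open
      (isOpen_setOf_approx_iterate f (htf.image _) (denseSeq C(ℂ, ℂ) j) _)
      (dense_setOf_approx_iterate f z₀ (htf.image _) ?_ (hφ.injOn_iterate hf htU ?_)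
        (fun z hz ↦ hφ.tendsto_iterate hf (htU hz)) _ Nat.one_div_pos_of_nat)
    · rintro n _ ⟨z, hz, rfl⟩
      exact hφ.iterate_ne_center hf z.2.1 ((hφ.eq_zero_iff hf z.2.1).not.1 (hD₀ (htD hz))) n
    · rintro _ ⟨a, ha, rfl⟩ _ ⟨b, hb, rfl⟩ hab
      exact congrArg _ (hDinj (htD ha) (htD hb) hab)
  filter_upwards [hg] with g hg
  have hK : ∀ᶠ K : NonemptyCompacts (bottcherNhd U φ δ) in residual _, ∀ j m : ℕ,
      ∃ n : ℕ, 1 ≤ n ∧ (K : Set (bottcherNhd U φ δ)) ⊆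
        {z | ∃ hz : f^[n] z ∈ ({z₀}ᶜ : Set ℂ),
          ‖g.1 ⟨f^[n] z, hz⟩ - denseSeq C(ℂ, ℂ) j z‖ < 1 / ((m : ℝ) + 1)} := by
    refine eventually_countable_forall.2 fun j ↦ eventually_countable_forall.2 fun m ↦
      residual_of_dense_open ?_ ?_
    · simp only [ofPred_exists, ofPred_and]
      exact isOpen_iUnion fun n ↦ isOpen_const.inter <|
        NonemptyCompacts.isOpen_subsets_of_isOpen <|
          hφ.isOpen_setOf_norm_sub_lt isOpen_compl_singleton g n _ _
    · have hdense : Dense {K : NonemptyCompacts (bottcherNhd U φ δ) |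
          (K : Set (bottcherNhd U φ δ)).Finite ∧ ↑K ⊆ D} := by
        rw [dense_iff_closure_eq, NonemptyCompacts.closure_finite_subsets, hDd.closure_eq]
        simp
      refine hdense.mono fun K hK ↦ ?_
      obtain ⟨n, hn1, hn⟩ := hg K hK j m
      exact ⟨n, hn1, fun z hz ↦ hn z (mem_image_of_mem _ hz)⟩
  filter_upwards [hK] with K hK using hφ.isUniversalFor hf hq hK
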